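/- For $n\ge 2$ and a set $\mathcal P$ of patterns, let $\mathcal S_n^{1\prec n}(\mathcal P)$ be the set of permutations $\sigma$ of $\{1,\dots,n\}$ that avoid every pattern in $\mathcal P$ (no subsequence of $\sigma(1)\sigma(2)\cdots\sigma(n)$ is order-isomorphic to a pattern in $\mathcal P$) and in which, in one-line notation, the entry $1$ is to the left of the entry $n$, that is, $\sigma^{-1}(1)<\sigma^{-1}(n)$. For $k\ge 1$ let $\mathcal S_{n,k}^{1\prec n}(\mathcal P)$ be the subset of those $\sigma$ with $\sigma^{-1}(n)-\sigma^{-1}(1)=k$. Then for every $n\ge 2$ \[ \bigl|\mathcal S_n^{1\prec n}(1243,1324)\bigr| \;=\; \sum_{k=1}^{n-1}\bigl|\mathcal S_{n,k}^{1\prec n}(1243,1324)\bigr| \;=\; \binom{2n-3}{n-1}. \] Moreover, with the reverse-complement $\sigma^{rc}(i)=n+1-\sigma(n+1-i)$, a permutation $\sigma$ of $\{1,\dots,n\}$ satisfies $\sigma\in\mathcal S_n^{1\prec n}(1324,2134)$ if and only if $\sigma^{rc}\in\mathcal S_n^{1\prec n}(1243,1324)$, and consequently \[ \bigl|\mathcal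 S_n^{1\prec n}(1324,2134)\bigr| \;=\; \binom{2n-3}{n-1}. \] -/

import Mathlib

/-- A permutation `σ` of size `n` is an element of `Equiv.Perm (Fin n)`, where `σ i` is the value at
position `i`. Positions and values are counted from `0`, so the entry in the usual one-line notation
on `{1, …, n}` is `σ i + 1`. -/
def entry {n : ℕ} (σ : Equiv.Perm (Fin n)) (i : Fin n) : ℕ := (σ i : ℕ) + 1

/-- `σ` contains the pattern `p` if some subsequence of `σ` (read from left to right) is
order-isomorphic to `p`. -/
def ContainsPattern {n m : ℕ} (σ : Equiv.Perm (Fin n)) (p : Equiv.Perm (Fin m)) : Prop :=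
  ∃ f : Fin m → Fin n, StrictMono f ∧ ∀ i j, σ (f i) < σ (f j) ↔ p i < p j

/-- The set of permutations of size `n` that avoid every pattern in `P`. -/
def avoiders (n : ℕ) {m : ℕ} (P : Set (Equiv.Perm (Fin m))) : Set (Equiv.Perm (Fin n)) :=
  {σ | ∀ p ∈ P, ¬ ContainsPattern σ p}

/-- The permutations of size `n` avoiding `P` in which entry `1` is to the left of entry `n`. -/
def avoidersOneBeforeMax (n : ℕ) {m : ℕ} (P : Set (Equiv.Perm (Fin m))) :
    Set (Equiv.Perm (Fin n)) :=
  {σ | σ ∈ avoiders n P ∧ ∃ i j : Fin n, entry σ i = 1 ∧ entry σ j = n ∧ i < j}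

/-- The permutations of size `n` avoiding `P` in which the position of entry `n` minus the position
of entry `1` equals `k`; for `k ≥ 1`, entry `1` is to the left of entry `n` at distance `k`. -/
def avoidersOneBeforeMaxAt (n k : ℕ) {m : ℕ} (P : Set (Equiv.Perm (Fin m))) :
    Set (Equiv.Perm (Fin n)) :=
  {σ | σ ∈ avoiders n P ∧ ∃ i j : Fin n, entry σ i = 1 ∧ entry σ j = n ∧ (j : ℤ) - (i : ℤ) = k}

/-- The reverse-complement `σ^rc (i) = n + 1 - σ (n + 1 - i)` (in `1`-based notation). -/
def reverseComplement {n : ℕ} (σ : Equiv.Perm (Fin n)) : Equiv.Perm (Fin n) :=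
  (Fin.revPerm.trans σ).trans Fin.revPerm

/-- The pattern `1243`, given by its one-line notation with values counted from `0`. -/
def pattern1243 : Equiv.Perm (Fin 4) :=
  ⟨![0, 1, 3, 2], ![0, 1, 3, 2], by decide, by decide⟩

/-- The pattern `1324`, given by its one-line notation with values counted from `0`. -/
def pattern1324 : Equiv.Perm (Fin 4) :=
  ⟨![0, 2, 1, 3], ![0, 2, 1, 3], by decide, by decide⟩

/-- The pattern `2134`, given by its one-line notation with values counted from `0`. -/
def pattern2134 : Equiv.Perm (Fin 4) :=
  ⟨![1, 0, 2, 3], ![1, 0, 2, 3], by decide, by decide⟩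

/-! Reverse-complement fixes `1324`, exchanges `2134` with `1243` and keeps the minimum to the left
of the maximum, so it is enough to count for `1324, 2134`. Write such a permutation of `0, …, M + 1`
as `A 0 B N C` with `N = M + 1`. Using `0` as the smallest letter of a pattern and `N` as its
largest turns avoidance into the conditions `Admissible` on shorter patterns in `A`, `B`, `C`
(`Split.valid_iff_join`).

Admissible splits form a generating tree. Let `m` be the largest entry other than `N`. If `m` lies
right of `N`, delete `N`, so that `m` becomes the maximum and `B` absorbs the entries between them;
otherwise delete `m`. Conversely, a split with `|B| = k` has `k + 1` children of the first kind,
with middle lengths `0, …, k`. Of the second kind it always has two: if `A` is empty, `m` goes to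
the end of `B` or into `A`; if not, `m` goes to the front of `A` or just after its first increasing
layer, since a list avoiding `213` and `132` is a sequence of increasing runs, each lying below the
previous one (`firstLayer`).

Hence the number of children of each type depends only on whether `A` is empty and on `k`. The
counts of splits with middle length at least `j` satisfy a recurrence solved by binomial
coefficients (`countGE_generate`); `j = 0` gives the total. -/

/-! ### Splits and their generating tree -/

/-- A list of the form `left ++ 0 :: mid ++ N :: right`, with its minimum `0` and its maximum `N`
left out. -/
@[ext]
structure Split where
  left : List ℕ
  mid : List ℕ
  right : List ℕ

namespace Split

/-- `z` lies above the descent `x y`. -/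
def Is213 (x y z : ℕ) : Prop := y < x ∧ x < z

/-- `z` lies strictly between `x` and `y` in an ascent `x y`. -/
def Is132 (x y z : ℕ) : Prop := x < z ∧ z < y

/-- The conditions on a split under which the list it encodes avoids `1324` and `2134`. -/
structure Admissible (t : Split) : Prop where
  mid_lt : t.mid.Pairwise (· < ·)
  mid_lt_left : ∀ a ∈ t.left, ∀ b ∈ t.mid, b < a
  left_213 : t.left.Triplewise fun x y z => ¬ Is213 x y z
  left_132 : t.left.Triplewise fun x y z => ¬ Is132 x y z
  right_213 : (t.mid ++ t.right).Triplewise fun x y z => ¬ Is213 x y z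
  right_anti : ∀ a ∈ t.left, t.right.Pairwise fun x y => ¬ (a < x ∧ x < y)

/-- The entries of the split are `1, …, M`, each occurring once. -/
structure Entries (M : ℕ) (t : Split) : Prop where
  nodup : (t.left ++ t.mid ++ t.right).Nodup
  mem_iff : ∀ x, x ∈ t.left ++ t.mid ++ t.right ↔ 1 ≤ x ∧ x ≤ M

/-- The splits obtained by inserting the new maximum `m` after the entry `0` and then shortening
the middle part. -/
def rightChildren (m : ℕ) (t : Split) : List Split :=
  (List.range (t.mid.length + 1)).map fun i => ⟨t.left, t.mid.take i, t.mid.drop i ++ m :: t.right⟩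

/-- The splits obtained by inserting the new maximum `m` at the end of the middle part or in the
left part. -/
def otherChildren (m : ℕ) : Split → List Split
  | ⟨[], B, C⟩ => [⟨[], B ++ [m], C⟩, ⟨[m], B, C⟩]
  | ⟨a :: l, B, C⟩ =>
    [⟨m :: a :: l, B, C⟩,
      ⟨a :: (l.takeWhile (a ≤ ·) ++ m :: l.dropWhile (a ≤ ·)), B, C⟩]

/-- All admissible splits that arise from `t` by inserting a new maximum `m`. -/
def children (m : ℕ) (t : Split) : List Split := rightChildren m t ++ otherChildren m t

/-- The split from which `s` arises by inserting `m`. -/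
def parent (m : ℕ) (s : Split) : Split :=
  if m ∈ s.right then
    ⟨s.left, s.mid ++ s.right.takeWhile (· ≠ m), (s.right.dropWhile (· ≠ m)).tail⟩
  else ⟨s.left.erase m, s.mid.erase m, s.right⟩

/-- The generating tree of admissible splits. -/
def generate : ℕ → List Split
  | 0 => [⟨[], [], []⟩]
  | M + 1 => (generate M).flatMap (children (M + 1))

/-! ### Children, parents and their entries -/

theorem mem_rightChildren {m : ℕ} {s t : Split} :
    s ∈ rightChildren m t ↔
      ∃ B D, t.mid = B ++ D ∧ s = ⟨t.left, B, D ++ m :: t.right⟩ := by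
  simp only [rightChildren, List.mem_map, List.mem_range]
  constructor
  · rintro ⟨i, -, rfl⟩
    exact ⟨_, _, (List.take_append_drop i t.mid).symm, rfl⟩
  · rintro ⟨B, D, h, rfl⟩
    exact ⟨B.length, by simp [h], by simp [h]⟩

theorem takeWhile_ne_append_cons {m : ℕ} {P C : List ℕ} (h : m ∉ P) :
    (P ++ m :: C).takeWhile (· ≠ m) = P ∧ (P ++ m :: C).dropWhile (· ≠ m) = m :: C := by
  induction P with
  | nil => simp
  | cons a P ih =>
    have ha : a ≠ m := fun e => h (by simp [e])
    have := ih fun hm => h (by simp [hm])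
    simpa [ha] using this

/-- Different splits therefore have no common child, which is what keeps `generate` free of
repetitions. -/
theorem parent_of_mem_children {m : ℕ} {s t : Split} (hA : m ∉ t.left) (hB : m ∉ t.mid)
    (hC : m ∉ t.right) (h : s ∈ children m t) : parent m s = t := by
  obtain ⟨A, B, C⟩ := t
  rcases List.mem_append.1 h with h | h
  · obtain ⟨B, D, rfl, rfl⟩ := mem_rightChildren.1 h
    have hD : m ∉ D := fun hx => hB (by simp [hx])
    simp only [parent, (takeWhile_ne_append_cons hD).1, (takeWhile_ne_append_cons hD).2]
    simp
  · simp only at hA hB hC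
    cases A with
    | nil =>
      simp only [otherChildren, List.mem_cons, List.not_mem_nil, or_false] at h
      rcases h with rfl | rfl <;> simp [parent, hC, List.erase_append, hB]
    | cons a l =>
      simp only [otherChildren, List.mem_cons, List.not_mem_nil, or_false] at h
      have hl : m ∉ l.takeWhile (a ≤ ·) := fun hx =>
        hA (List.mem_cons_of_mem _ ((List.takeWhile_sublist _).subset hx))
      have ha : a ≠ m := fun e => hA (by simp [e])
      rcases h with rfl | rfl <;> simp [parent, hC, hB, List.erase_append, hl, ha]

theorem nodup_children {m : ℕ} {t : Split} (hA : m ∉ t.left) (hC : m ∉ t.right) :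
    (children m t).Nodup := by
  refine List.Nodup.append ?_ ?_ ?_
  · refine List.Nodup.map_on (fun i hi j hj hij => ?_) List.nodup_range
    simp only [List.mem_range] at hi hj
    have := congrArg (fun s => s.mid.length) hij
    simp only [List.length_take] at this
    omega
  · obtain ⟨_ | ⟨a, l⟩, B, C⟩ := t
    · simp [otherChildren]
    · have ha : m ≠ a := fun e => hA (by simp [e])
      refine List.nodup_cons.2 ⟨fun h => ha ?_, List.nodup_singleton _⟩
      have := congrArg Split.left (List.mem_singleton.1 h)
      exact (List.cons.inj this).1
  · intro s hs hs'
    obtain ⟨B, D, h, rfl⟩ := mem_rightChildren.1 hs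
    have : D ++ m :: t.right = t.right := by
      obtain ⟨_ | ⟨a, l⟩, B', C⟩ := t <;>
        rcases List.mem_cons.1 hs' with h | h
      exacts [congrArg Split.right h, congrArg Split.right (List.mem_singleton.1 h),
        congrArg Split.right h, congrArg Split.right (List.mem_singleton.1 h)]
    exact hC (by rw [← this]; simp)

theorem Entries.of_insert {M : ℕ} {s t : Split}
    (h : List.Perm (s.left ++ s.mid ++ s.right) ((M + 1) :: (t.left ++ t.mid ++ t.right))) :
    Entries (M + 1) s ↔ Entries M t := by
  constructor
  · rintro ⟨h1, h2⟩
    have h1' := h.nodup_iff.1 h1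
    refine ⟨(List.nodup_cons.1 h1').2, fun x => ?_⟩
    have := h2 x
    rw [h.mem_iff, List.mem_cons] at this
    have h3 := (List.nodup_cons.1 h1').1
    grind
  · rintro ⟨h1, h2⟩
    refine ⟨h.nodup_iff.2 (List.nodup_cons.2 ⟨by rw [h2]; omega, h1⟩), fun x => ?_⟩
    rw [h.mem_iff, List.mem_cons, h2]
    omega

theorem perm_of_mem_children {m : ℕ} {s t : Split} (h : s ∈ children m t) :
    List.Perm (s.left ++ s.mid ++ s.right) (m :: (t.left ++ t.mid ++ t.right)) := by
  obtain ⟨A, B, C⟩ := t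
  rcases List.mem_append.1 h with h | h
  · obtain ⟨B, D, rfl, rfl⟩ := mem_rightChildren.1 h
    simpa using List.perm_middle (a := m) (l₁ := A ++ B ++ D) (l₂ := C)
  · cases A with
    | nil =>
      simp only [otherChildren, List.mem_cons, List.not_mem_nil, or_false] at h
      rcases h with rfl | rfl
      · simp
      · simp
    | cons a l =>
      simp only [otherChildren, List.mem_cons, List.not_mem_nil, or_false] at h
      rcases h with rfl | rfl
      · simp
      · have := List.perm_middle (a := m) (l₁ := a :: l.takeWhile (a ≤ ·))
          (l₂ := l.dropWhile (a ≤ ·) ++ B ++ C)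
        have e := List.takeWhile_append_dropWhile (p := (a ≤ ·)) (l := l)
        conv_rhs at this =>
          rw [← List.append_assoc, ← List.append_assoc, List.cons_append, e]
        simpa using this

/-! ### Admissibility under insertion of a maximum -/

/-- A maximum can only be the last letter of a `213`, so the new constraint is that no descent
precedes it. -/
theorem triplewise_213_insert {m : ℕ} {P C : List ℕ} (hP : ∀ x ∈ P, x < m) (hC : ∀ x ∈ C, x < m)
    (hnd : P.Nodup) :
    ((P ++ m :: C).Triplewise fun x y z => ¬ Is213 x y z) ↔
      ((P ++ C).Triplewise fun x y z => ¬ Is213 x y z) ∧ P.Pairwise (· < ·) := by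
  have key : P.Pairwise (fun x y => ¬ Is213 x y m) ↔ P.Pairwise (· < ·) := by
    constructor
    · intro h
      refine (h.and hnd).imp_of_mem fun {x y} hx hy hxy => ?_
      have := hP x hx
      obtain ⟨h1, h2⟩ := hxy
      simp only [Is213] at h1
      omega
    · intro h
      refine h.imp fun hxy => by simp only [Is213]; omega
  have e1 : C.Pairwise (fun x y => ¬ Is213 m x y) :=
    List.pairwise_of_forall_mem_list fun x hx y hy h => by have := hC y hy; have := h.2; omega
  have e2 : ∀ a ∈ P, ∀ x ∈ C, ¬ Is213 a m x := fun a ha x hx h => by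
    have := hP a ha; have := h.1; omega
  simp only [List.triplewise_append, List.triplewise_cons, List.pairwise_cons, List.mem_cons,
    forall_eq_or_imp, key]
  grind

/-- A maximum can only be the middle letter of a `132`, so the new constraint concerns only pairs on
opposite sides of it. -/
theorem triplewise_132_insert {m : ℕ} {P C : List ℕ} (hP : ∀ x ∈ P, x < m) (hC : ∀ x ∈ C, x < m)
    (hnd : (P ++ C).Nodup) :
    ((P ++ m :: C).Triplewise fun x y z => ¬ Is132 x y z) ↔
      ((P ++ C).Triplewise fun x y z => ¬ Is132 x y z) ∧ ∀ a ∈ P, ∀ d ∈ C, d < a := by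
  have key : (∀ a ∈ P, ∀ d ∈ C, ¬ Is132 a m d) ↔ ∀ a ∈ P, ∀ d ∈ C, d < a := by
    rw [List.nodup_append] at hnd
    refine forall₄_congr fun a ha d hd => ?_
    have := hC d hd
    have := hnd.2.2 a ha d hd
    simp only [Is132]; omega
  have e1 : C.Pairwise (fun x y => ¬ Is132 m x y) :=
    List.pairwise_of_forall_mem_list fun x hx y hy h => by
      have := hC x hx; have := hC y hy; have := h.1; omega
  have e2 : P.Pairwise (fun x y => ¬ Is132 x y m) :=
    List.pairwise_of_forall_mem_list fun x hx y hy h => by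
      have := hP y hy; have := h.2; omega
  simp only [List.triplewise_append, List.triplewise_cons, List.pairwise_cons, List.mem_cons,
    forall_eq_or_imp]
  grind

/-- Deleting `N` from `A 0 B N C m D` leaves `A 0 B C m D`, with `m` as the maximum. The conditions
on the longer middle part `B ++ C` are those that `m` imposed from the right: avoiding `213` makes
`B ++ C` increasing, and `right_anti` applied to an entry of `C` followed by `m` puts `C` below `A`.
-/
theorem admissible_right_iff {m : ℕ} {A B C D : List ℕ}
    (hB : ∀ x ∈ B, x < m) (hC : ∀ x ∈ C, x < m) (hD : ∀ x ∈ D, x < m)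
    (hnd : (A ++ B ++ C ++ D).Nodup) :
    Admissible ⟨A, B, C ++ m :: D⟩ ↔ Admissible ⟨A, B ++ C, D⟩ := by
  have hBC : ∀ x ∈ B ++ C, x < m := by grind
  have hnd' : (B ++ C).Nodup := hnd.sublist (by
    simp only [List.append_assoc]
    exact (List.Sublist.append_left (List.sublist_append_left C D) B).trans
      (List.sublist_append_right _ _))
  have key := triplewise_213_insert hBC hD hnd'
  constructor
  · rintro ⟨h1, h2, h3, h4, h5, h6⟩
    rw [← List.append_assoc, key] at h5
    refine ⟨h5.2, fun a ha b hb => ?_, h3, h4, h5.1, fun a ha => ?_⟩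
    · rcases List.mem_append.1 hb with hb | hb
      · exact h2 a ha b hb
      · have := (List.pairwise_append.1 (h6 a ha)).2.2 b hb m (by simp)
        have := hC b hb
        have : a ≠ b := by
          simp only [List.append_assoc] at hnd
          exact (List.nodup_append.1 hnd).2.2 a ha b (by simp [hb])
        omega
    · exact (List.pairwise_cons.1 (List.pairwise_append.1 (h6 a ha)).2.1).2
  · rintro ⟨h1, h2, h3, h4, h5, h6⟩
    refine ⟨(List.pairwise_append.1 h1).1, fun a ha b hb => h2 a ha b (by simp [hb]), h3, h4, ?_,
      fun a ha => ?_⟩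
    · rw [← List.append_assoc, key]
      exact ⟨h5, h1⟩
    · have := h6 a ha
      have hc : ∀ c ∈ C, c < a := fun c hc => h2 a ha c (by simp [hc])
      simp only [List.pairwise_append, List.pairwise_cons]
      refine ⟨List.pairwise_of_forall_mem_list fun x hx y hy h => ?_, ⟨fun x hx h => ?_, this⟩,
        fun x hx y hy h => ?_⟩
      · have := hc x hx; omega
      · have := hD x hx; omega
      · have := hc x hx; omega

/-- Only an empty left part is of interest, because `mid_lt_left` forbids a maximum in the middle
otherwise. -/
theorem admissible_mid_iff {m : ℕ} {B C : List ℕ}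
    (hB : ∀ x ∈ B, x < m) (hC : ∀ x ∈ C, x < m) (hnd : B.Nodup) :
    Admissible ⟨[], B ++ [m], C⟩ ↔ Admissible ⟨[], B, C⟩ := by
  have key := triplewise_213_insert hB hC hnd
  constructor
  · rintro ⟨h1, h2, h3, h4, h5, h6⟩
    rw [List.append_assoc, List.singleton_append, key] at h5
    exact ⟨h5.2, by simp, h3, h4, h5.1, by simp⟩
  · rintro ⟨h1, h2, h3, h4, h5, h6⟩
    refine ⟨?_, by simp, h3, h4, ?_, by simp⟩
    · simpa [List.pairwise_append] using ⟨h1, hB⟩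
    · rw [List.append_assoc, List.singleton_append, key]
      exact ⟨h5, h1⟩

/-- A maximum in the left part lies above all of `B` and `C`, so only the `213` and `132` conditions
within the left part impose anything new. -/
theorem admissible_left_iff {m : ℕ} {A D B C : List ℕ}
    (hA : ∀ x ∈ A, x < m) (hB : ∀ x ∈ B, x < m) (hC : ∀ x ∈ C, x < m) (hD : ∀ x ∈ D, x < m)
    (hnd : (A ++ D).Nodup) :
    Admissible ⟨A ++ m :: D, B, C⟩ ↔ Admissible ⟨A ++ D, B, C⟩ ∧ A.Pairwise (· < ·) ∧
      ∀ a ∈ A, ∀ d ∈ D, d < a := by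
  have k1 := triplewise_213_insert hA hD (List.nodup_append.1 hnd).1
  have k2 := triplewise_132_insert hA hD hnd
  constructor
  · rintro ⟨h1, h2, h3, h4, h5, h6⟩
    rw [k1] at h3
    rw [k2] at h4
    exact ⟨⟨h1, fun a ha => h2 a (by grind), h3.1, h4.1, h5, fun a ha => h6 a (by grind)⟩,
      h3.2, h4.2⟩
  · rintro ⟨⟨h1, h2, h3, h4, h5, h6⟩, h7, h8⟩
    have hmem : ∀ a ∈ A ++ m :: D, a = m ∨ a ∈ A ++ D := by grind
    refine ⟨h1, fun a ha b hb => ?_, k1.2 ⟨h3, h7⟩, k2.2 ⟨h4, h8⟩, h5, fun a ha => ?_⟩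
    · rcases hmem a ha with rfl | h
      · exact hB b hb
      · exact h2 a h b hb
    · rcases hmem a ha with rfl | h
      · exact List.pairwise_of_forall_mem_list fun x hx y hy h => by have := hC x hx; omega
      · exact h6 a h

/-- In a list that avoids `213` and `132`, the entries from the first one on that are not below it
form an increasing run, and all later entries are below it. -/
theorem firstLayer {a : ℕ} {l : List ℕ} (hnd : (a :: l).Nodup)
    (h1 : (a :: l).Triplewise fun x y z => ¬ Is213 x y z)
    (h2 : (a :: l).Triplewise fun x y z => ¬ Is132 x y z) :
    (a :: l.takeWhile (a ≤ ·)).Pairwise (· < ·) ∧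
      ∀ x ∈ a :: l.takeWhile (a ≤ ·), ∀ d ∈ l.dropWhile (a ≤ ·), d < x := by
  have hsub : (l.takeWhile (a ≤ ·)).Sublist l := List.takeWhile_sublist _
  have hal := List.nodup_cons.1 hnd
  have hlt : ∀ x ∈ l.takeWhile (a ≤ ·), a < x := fun x hx => by
    have h := List.mem_takeWhile_imp hx
    have : a ≠ x := fun e => hal.1 (e ▸ hsub.subset hx)
    simp only [decide_eq_true_eq] at h
    omega
  refine ⟨List.pairwise_cons.2 ⟨hlt, ?_⟩, ?_⟩
  -- Two entries above `a` in descending order would form a `132` with `a`.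
  · refine (((List.triplewise_cons.1 h2).1.and hal.2).sublist hsub).imp_of_mem
      fun {x y} _ hy hxy => ?_
    have := hlt y hy
    obtain ⟨h1, h2⟩ := hxy
    simp only [Is132] at h1
    omega
  -- The first dropped entry `d` is below `a`; a later entry `e` above `a` would make `a d e` a
  -- `213`.
  · have hd : ∀ d ∈ l.dropWhile (a ≤ ·), d < a := by
      have hsub' : (l.dropWhile (a ≤ ·)).Sublist l := List.dropWhile_sublist _
      have hp := (List.triplewise_cons.1 h1).1.sublist hsub'
      have hhead := List.head?_dropWhile_not (a ≤ ·) l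
      generalize l.dropWhile (a ≤ ·) = D at hsub' hp hhead
      cases D with
      | nil => simp
      | cons d D =>
        have hda : d < a := by simpa using hhead
        intro e he
        rcases List.mem_cons.1 he with rfl | he'
        · exact hda
        · have := (List.pairwise_cons.1 hp).1 e he'
          have : a ≠ e := fun h => hal.1 (h ▸ hsub'.subset he)
          simp only [Is213] at *
          omega
    intro x hx d hdm
    have := hd d hdm
    rcases List.mem_cons.1 hx with rfl | hx
    · exact this
    · exact this.trans (hlt x hx)

/-- Converse to `firstLayer`: a nonempty prefix meeting the two conditions of `admissible_left_iff`
is exactly the first layer, so there is only one insertion place besides the front. -/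
theorem firstLayer_unique {a : ℕ} {T D : List ℕ} (h1 : (a :: T).Pairwise (· < ·))
    (h2 : ∀ x ∈ a :: T, ∀ d ∈ D, d < x) :
    (T ++ D).takeWhile (a ≤ ·) = T ∧ (T ++ D).dropWhile (a ≤ ·) = D := by
  have hT : ∀ x ∈ T, (fun x => decide (a ≤ x)) x = true := fun x hx => by
    simpa using ((List.pairwise_cons.1 h1).1 x hx).le
  rw [List.takeWhile_append_of_pos hT, List.dropWhile_append_of_pos hT]
  cases D with
  | nil => simp
  | cons d D =>
    have := h2 a (by simp) d (by simp)
    simp [this]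

/-! ### The tree lists every valid split exactly once -/

/-- A split with entries `1, …, M` that encodes a list avoiding `1324` and `2134`. -/
def Valid (M : ℕ) (t : Split) : Prop := Entries M t ∧ Admissible t

theorem Entries.lt {M : ℕ} {t : Split} (h : Entries M t) :
    (∀ x ∈ t.left, x < M + 1) ∧ (∀ x ∈ t.mid, x < M + 1) ∧ ∀ x ∈ t.right, x < M + 1 := by
  have := fun x => (h.mem_iff x).1
  simp only [List.mem_append] at this
  refine ⟨fun x hx => ?_, fun x hx => ?_, fun x hx => ?_⟩ <;>
    exact Nat.lt_succ_of_le (this x (by simp [hx])).2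

theorem Entries.nodup_parts {M : ℕ} {t : Split} (h : Entries M t) :
    t.left.Nodup ∧ t.mid.Nodup := by
  have := (List.nodup_append.1 h.nodup).1
  exact ⟨(List.nodup_append.1 this).1, (List.nodup_append.1 this).2.1⟩

theorem Valid.of_mem_children {M : ℕ} {s t : Split} (ht : Valid M t)
    (h : s ∈ children (M + 1) t) : Valid (M + 1) s := by
  obtain ⟨he, ha⟩ := ht
  refine ⟨(Entries.of_insert (perm_of_mem_children h)).2 he, ?_⟩
  obtain ⟨hA, hB, hC⟩ := he.lt
  obtain ⟨nA, nB⟩ := he.nodup_parts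
  have hnd := he.nodup
  obtain ⟨A, B, C⟩ := t
  simp only at hA hB hC nA nB hnd
  rcases List.mem_append.1 h with h | h
  · obtain ⟨B, D, rfl, rfl⟩ := mem_rightChildren.1 h
    exact (admissible_right_iff (fun x hx => hB x (List.mem_append_left _ hx))
      (fun x hx => hB x (List.mem_append_right _ hx)) hC (by simpa using hnd)).2 ha
  · cases A with
    | nil =>
      simp only [otherChildren, List.mem_cons, List.not_mem_nil, or_false] at h
      rcases h with rfl | rfl
      · exact (admissible_mid_iff hB hC nB).2 ha
      · exact (admissible_left_iff (A := []) (D := []) hA hB hC hA nA).2 ⟨ha, by simp, by simp⟩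
    | cons a l =>
      simp only [otherChildren, List.mem_cons, List.not_mem_nil, or_false] at h
      rcases h with rfl | rfl
      · exact (admissible_left_iff (A := []) (by simp) hB hC hA nA).2 ⟨ha, by simp, by simp⟩
      · have e := List.takeWhile_append_dropWhile (p := (a ≤ ·)) (l := l)
        have hl := firstLayer nA ha.left_213 ha.left_132
        refine (admissible_left_iff (A := a :: l.takeWhile (a ≤ ·)) ?_ hB hC ?_ ?_).2 ⟨?_, hl⟩
        · intro x hx
          exact hA x (((List.takeWhile_sublist _).cons_cons a).subset hx)
        · intro x hx
          exact hA x (List.mem_cons_of_mem _ ((List.dropWhile_sublist _).subset hx))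
        · rwa [List.cons_append, e]
        · rwa [List.cons_append, e]

theorem Valid.exists_mem_children {M : ℕ} {s : Split} (hs : Valid (M + 1) s) :
    ∃ t, Valid M t ∧ s ∈ children (M + 1) t := by
  obtain ⟨he, ha⟩ := hs
  have hm := (he.mem_iff (M + 1)).2 ⟨by omega, le_rfl⟩
  obtain ⟨A, B, C⟩ := s
  simp only [List.mem_append] at hm
  rcases hm with (hm | hm) | hm
  · obtain ⟨A, D, rfl⟩ := List.append_of_mem hm
    have het : Entries M ⟨A ++ D, B, C⟩ := (Entries.of_insert (by
      simp)).1 he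
    obtain ⟨hA, hB, hC⟩ := het.lt
    have nA := het.nodup_parts.1
    simp only at hA hB hC nA
    have hat := (admissible_left_iff (fun x hx => hA x (List.mem_append_left _ hx)) hB hC
      (fun x hx => hA x (List.mem_append_right _ hx)) nA).1 ha
    refine ⟨_, ⟨het, hat.1⟩, List.mem_append_right _ ?_⟩
    cases A with
    | nil => cases D <;> simp [otherChildren]
    | cons a T =>
      have := firstLayer_unique hat.2.1 hat.2.2
      simp [otherChildren, this]
  · obtain ⟨B, D, rfl⟩ := List.append_of_mem hm
    have hmid := List.pairwise_append.1 ha.mid_lt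
    have hD : D = [] := by
      refine List.eq_nil_iff_forall_not_mem.2 fun x hx => ?_
      have h1 := (List.pairwise_cons.1 hmid.2.1).1 x hx
      have h2 := ((he.mem_iff x).1 (by simp [hx])).2
      omega
    have hA : A = [] := by
      refine List.eq_nil_iff_forall_not_mem.2 fun x hx => ?_
      have h1 := ha.mid_lt_left x hx (M + 1) (by simp)
      have h2 := ((he.mem_iff x).1 (by simp [hx])).2
      omega
    subst hA hD
    have het : Entries M ⟨[], B, C⟩ := (Entries.of_insert (by
      simp)).1 he
    obtain ⟨-, hB, hC⟩ := het.lt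
    exact ⟨_, ⟨het, (admissible_mid_iff hB hC het.nodup_parts.2).1 ha⟩,
      List.mem_append_right _ (by simp [otherChildren])⟩
  · obtain ⟨C, D, rfl⟩ := List.append_of_mem hm
    have het : Entries M ⟨A, B ++ C, D⟩ := (Entries.of_insert (by
      simpa using List.perm_middle (l₁ := A ++ B ++ C) (l₂ := D))).1 he
    obtain ⟨-, hB, hD⟩ := het.lt
    have hnd := het.nodup
    simp only at hB hD hnd
    have hat := (admissible_right_iff (fun x hx => hB x (List.mem_append_left _ hx))
      (fun x hx => hB x (List.mem_append_right _ hx)) hD (by simpa using hnd)).1 ha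
    exact ⟨_, ⟨het, hat⟩, List.mem_append_left _ (mem_rightChildren.2 ⟨_, _, rfl, rfl⟩)⟩

theorem mem_generate {M : ℕ} {t : Split} : t ∈ generate M ↔ Valid M t := by
  induction M generalizing t with
  | zero =>
    simp only [generate, List.mem_singleton]
    constructor
    · rintro rfl
      exact ⟨⟨by simp, by simp; omega⟩, ⟨by simp, by simp, by simp, by simp, by simp, by simp⟩⟩
    · rintro ⟨he, -⟩
      have h := List.eq_nil_iff_forall_not_mem.2 fun x hx => by
        have := (he.mem_iff x).1 hx
        omega
      simp only [List.append_eq_nil_iff] at h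
      exact Split.ext h.1.1 h.1.2 h.2
  | succ M ih =>
    simp only [generate, List.mem_flatMap]
    exact ⟨fun ⟨s, hs, h⟩ => (ih.1 hs).of_mem_children h, fun h =>
      let ⟨s, hs, h⟩ := h.exists_mem_children
      ⟨s, ih.2 hs, h⟩⟩

theorem Valid.not_mem {M : ℕ} {t : Split} (h : Valid M t) :
    M + 1 ∉ t.left ∧ M + 1 ∉ t.mid ∧ M + 1 ∉ t.right := by
  obtain ⟨hA, hB, hC⟩ := h.1.lt
  exact ⟨fun h => (hA _ h).false, fun h => (hB _ h).false, fun h => (hC _ h).false⟩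

theorem nodup_generate (M : ℕ) : (generate M).Nodup := by
  induction M with
  | zero => simp [generate]
  | succ M ih =>
    refine List.nodup_flatMap.2 ⟨fun t ht => ?_, ?_⟩
    · obtain ⟨hA, hB, hC⟩ := (mem_generate.1 ht).not_mem
      exact nodup_children hA hC
    · refine List.Pairwise.imp_of_mem (fun {s t} hs ht hst u hu hu' => hst ?_) ih
      obtain ⟨hA, hB, hC⟩ := (mem_generate.1 hs).not_mem
      obtain ⟨hA', hB', hC'⟩ := (mem_generate.1 ht).not_mem
      rw [← parent_of_mem_children hA hB hC hu, parent_of_mem_children hA' hB' hC' hu']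

/-! ### Counting by emptiness of the left part and length of the middle part -/

/-- The number of `t ∈ l` with empty left part and `t.mid.length = j`. -/
def countEmpty (l : List Split) (j : ℕ) : ℕ :=
  l.countP fun t => t.left = [] ∧ t.mid.length = j

def countEmptyGE (l : List Split) (j : ℕ) : ℕ :=
  l.countP fun t => t.left = [] ∧ j ≤ t.mid.length

def countCons (l : List Split) (j : ℕ) : ℕ :=
  l.countP fun t => t.left ≠ [] ∧ t.mid.length = j

def countConsGE (l : List Split) (j : ℕ) : ℕ :=
  l.countP fun t => t.left ≠ [] ∧ j ≤ t.mid.length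

theorem countEmptyGE_eq (l : List Split) (j : ℕ) :
    countEmptyGE l j = countEmpty l j + countEmptyGE l (j + 1) := by
  induction l with
  | nil => rfl
  | cons t l ih =>
    simp only [countEmptyGE, countEmpty, List.countP_cons, decide_eq_true_eq] at *
    grind

theorem countConsGE_eq (l : List Split) (j : ℕ) :
    countConsGE l j = countCons l j + countConsGE l (j + 1) := by
  induction l with
  | nil => rfl
  | cons t l ih =>
    simp only [countConsGE, countCons, List.countP_cons, decide_eq_true_eq] at *
    grind

/-- The `min` is the form in which `List.length_take` gives the middle length of a right child. -/
theorem countP_range_min_eq (k j : ℕ) :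
    (List.range (k + 1)).countP (fun i => min i k = j) = if j ≤ k then 1 else 0 := by
  have : (List.range (k + 1)).countP (fun i => min i k = j) = (List.range (k + 1)).count j := by
    rw [List.count]
    refine List.countP_congr fun i hi => ?_
    simp only [List.mem_range] at hi
    simp; omega
  rw [this, List.nodup_range.count]
  simp

theorem countEmpty_rightChildren (m : ℕ) (t : Split) (j : ℕ) :
    countEmpty (rightChildren m t) j = if t.left = [] ∧ j ≤ t.mid.length then 1 else 0 := by
  have := countP_range_min_eq t.mid.length j
  by_cases h : t.left = []
  · simpa [countEmpty, rightChildren, List.countP_map, Function.comp_def, h] using this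
  · simp [countEmpty, rightChildren, List.countP_map, Function.comp_def, h]

theorem countCons_rightChildren (m : ℕ) (t : Split) (j : ℕ) :
    countCons (rightChildren m t) j = if t.left ≠ [] ∧ j ≤ t.mid.length then 1 else 0 := by
  have := countP_range_min_eq t.mid.length j
  by_cases h : t.left = []
  · simp [countCons, rightChildren, List.countP_map, Function.comp_def, h]
  · simpa [countCons, rightChildren, List.countP_map, Function.comp_def, h] using this

theorem countEmpty_children (m : ℕ) (t : Split) (j : ℕ) :
    countEmpty (children m t) j = (if t.left = [] ∧ j ≤ t.mid.length then 1 else 0) +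
      if t.left = [] ∧ t.mid.length + 1 = j then 1 else 0 := by
  have h := countEmpty_rightChildren m t j
  rw [countEmpty] at h
  rw [countEmpty, children, List.countP_append, h]
  obtain ⟨_ | ⟨a, l⟩, B, C⟩ := t <;> simp [otherChildren, List.countP_cons]

/-- The factor `2` counts the two places in a nonempty left part; the last term is the maximum
opening an empty one. -/
theorem countCons_children (m : ℕ) (t : Split) (j : ℕ) :
    countCons (children m t) j = (if t.left ≠ [] ∧ j ≤ t.mid.length then 1 else 0) +
      2 * (if t.left ≠ [] ∧ t.mid.length = j then 1 else 0) +
      if t.left = [] ∧ t.mid.length = j then 1 else 0 := by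
  have h := countCons_rightChildren m t j
  rw [countCons] at h
  rw [countCons, children, List.countP_append, h]
  obtain ⟨_ | ⟨a, l⟩, B, C⟩ := t <;> simp [otherChildren, List.countP_cons]
  grind

theorem countEmpty_flatMap_zero (m : ℕ) (l : List Split) :
    countEmpty (l.flatMap (children m)) 0 = countEmptyGE l 0 := by
  induction l with
  | nil => rfl
  | cons t l ih =>
    have h := countEmpty_children m t 0
    simp only [countEmpty, countEmptyGE, List.countP_cons, List.flatMap_cons,
      List.countP_append, decide_eq_true_eq] at *
    grind

theorem countEmpty_flatMap_succ (m : ℕ) (l : List Split) (j : ℕ) :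
    countEmpty (l.flatMap (children m)) (j + 1) = countEmptyGE l (j + 1) + countEmpty l j := by
  induction l with
  | nil => rfl
  | cons t l ih =>
    have h := countEmpty_children m t (j + 1)
    simp only [countEmpty, countEmptyGE, List.countP_cons, List.flatMap_cons,
      List.countP_append, decide_eq_true_eq] at *
    grind

theorem countCons_flatMap (m : ℕ) (l : List Split) (j : ℕ) :
    countCons (l.flatMap (children m)) j =
      countConsGE l j + 2 * countCons l j + countEmpty l j := by
  induction l with
  | nil => rfl
  | cons t l ih =>
    have h := countCons_children m t j
    simp only [countEmpty, countCons, countConsGE, List.countP_cons, List.flatMap_cons,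
      List.countP_append, decide_eq_true_eq] at *
    grind

theorem mid_length_le {M : ℕ} {t : Split} (ht : t ∈ generate M) : t.mid.length ≤ M := by
  induction M generalizing t with
  | zero =>
    simp only [generate, List.mem_singleton] at ht
    simp [ht]
  | succ M ih =>
    simp only [generate, List.mem_flatMap] at ht
    obtain ⟨s, hs, h⟩ := ht
    have := ih hs
    rcases List.mem_append.1 h with h | h
    · obtain ⟨B, D, h', rfl⟩ := mem_rightChildren.1 h
      simp only [h', List.length_append] at *
      omega
    · obtain ⟨_ | ⟨a, l⟩, B, C⟩ := s
      · simp only [otherChildren, List.mem_cons, List.not_mem_nil, or_false] at h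
        rcases h with rfl | rfl <;> simp at * <;> omega
      · simp only [otherChildren, List.mem_cons, List.not_mem_nil, or_false] at h
        rcases h with rfl | rfl <;> simp at * <;> omega

theorem countEmptyGE_top (M : ℕ) : countEmptyGE (generate M) (M + 1) = 0 := by
  refine List.countP_eq_zero.2 fun t ht => ?_
  have := mid_length_le ht
  simp; omega

theorem countConsGE_top (M : ℕ) : countConsGE (generate M) (M + 1) = 0 := by
  refine List.countP_eq_zero.2 fun t ht => ?_
  have := mid_length_le ht
  simp; omega

/-- With `d = M + 1 - j` the tail counts are binomial coefficients. -/
theorem countGE_generate (M : ℕ) : ∀ d j, d + j = M + 1 →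
    countConsGE (generate M) j = (M + d).choose (M + 2) ∧
      countEmptyGE (generate M) j + countConsGE (generate M) j = (M + d).choose (M + 1) := by
  induction M with
  | zero =>
    intro d j h
    have : (d = 1 ∧ j = 0) ∨ (d = 0 ∧ j = 1) := by omega
    rcases this with ⟨rfl, rfl⟩ | ⟨rfl, rfl⟩ <;>
      simp [generate, countConsGE, countEmptyGE]
  | succ M ih =>
    -- Differences of consecutive tail counts, evaluated by Pascal's rule.
    have exact_count : ∀ d j, d + j = M →
        countCons (generate M) j = (M + d).choose (M + 1) ∧
        countEmpty (generate M) j + countCons (generate M) j = (M + d).choose M := by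
      intro d j h
      have h1 := ih (d + 1) j (by omega)
      have h2 := ih d (j + 1) (by omega)
      have e1 := countConsGE_eq (generate M) j
      have e2 := countEmptyGE_eq (generate M) j
      have c1 := Nat.choose_succ_succ' (M + d) M
      have c2 := Nat.choose_succ_succ' (M + d) (M + 1)
      simp only [← add_assoc] at h1 h2 c1 c2
      simp only [Nat.add_assoc, Nat.reduceAdd] at *
      omega
    -- One Pascal step joins the two formulas of `exact_count`, so `d` is one larger here; `d = 0`
    -- is the case beyond the longest possible middle part, where both counts vanish.
    have twice : ∀ d j, d + j = M + 1 →
        2 * countCons (generate M) j + countEmpty (generate M) j = (M + d).choose (M + 1) := by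
      intro d j h
      cases d with
      | zero =>
        obtain rfl : j = M + 1 := by omega
        have h1 := countConsGE_eq (generate M) (M + 1)
        have h2 := countEmptyGE_eq (generate M) (M + 1)
        rw [countConsGE_top] at h1
        rw [countEmptyGE_top] at h2
        have c := Nat.choose_eq_zero_of_lt (show M + 0 < M + 1 by omega)
        omega
      | succ d =>
        have h1 := exact_count d j (by omega)
        have c := Nat.choose_succ_succ' (M + d) M
        rw [← Nat.add_assoc]
        omega
    intro d
    induction d with
    | zero =>
      intro j h
      obtain rfl : j = M + 2 := by omega
      have e1 := countConsGE_top (M + 1)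
      have e2 := countEmptyGE_top (M + 1)
      have c1 := Nat.choose_eq_zero_of_lt (show M + 1 < M + 2 by omega)
      have c2 := Nat.choose_eq_zero_of_lt (show M + 1 < M + 3 by omega)
      simp only [Nat.add_assoc, Nat.reduceAdd] at *
      omega
    | succ d ihd =>
      intro j h
      have h1 := ih d j (by omega)
      have h2 := twice d j (by omega)
      have h3 := ihd (j + 1) (by omega)
      have e1 := countConsGE_eq (generate (M + 1)) j
      have e2 := countEmptyGE_eq (generate (M + 1)) j
      have f1 : countCons (generate (M + 1)) j = _ := countCons_flatMap (M + 1) (generate M) j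
      -- For `j ≥ 1` the two binomials differ by `countEmpty (generate M) (j - 1)`; adding one on
      -- the left avoids truncated subtraction. For `j = 0` there is no such term, and the binomials
      -- agree by symmetry because `d = M + 1`.
      have f2 : countEmpty (generate (M + 1)) j + (M + d).choose (M + 1) =
          countEmptyGE (generate M) j + (M + d).choose M := by
        cases j with
        | zero =>
          have f : countEmpty (generate (M + 1)) 0 = _ :=
            countEmpty_flatMap_zero (M + 1) (generate M)
          obtain rfl : d = M + 1 := by omega
          have c := Nat.choose_symm_add (a := M + 1) (b := M)
          rw [Nat.add_comm (M + 1) M] at c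
          omega
        | succ j =>
          have f : countEmpty (generate (M + 1)) (j + 1) = _ :=
            countEmpty_flatMap_succ (M + 1) (generate M) j
          have := exact_count d j (by omega)
          omega
      have c1 := Nat.choose_succ_succ' (M + d + 1) (M + 2)
      have c2 := Nat.choose_succ_succ' (M + d + 1) (M + 1)
      have c3 := Nat.choose_succ_succ' (M + d) (M + 1)
      have c4 := Nat.choose_succ_succ' (M + d) M
      rw [show M + 1 + d = M + d + 1 by omega] at h3
      rw [show M + 1 + (d + 1) = M + d + 1 + 1 by omega]
      simp only [Nat.add_assoc, Nat.reduceAdd] at *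
      omega

theorem length_generate (M : ℕ) : (generate M).length = (2 * M + 1).choose (M + 1) := by
  have := (countGE_generate M (M + 1) 0 (by omega)).2
  rw [show 2 * M + 1 = M + (M + 1) by omega, ← this]
  simp only [countConsGE, countEmptyGE]
  induction generate M with
  | nil => rfl
  | cons t l ih => simp only [List.length_cons, List.countP_cons]; grind

end Split

/-! ### Admissible splits encode exactly the avoiding lists -/

theorem List.triplewise_iff_forall_sublist {α : Type*} {p : α → α → α → Prop} {l : List α} :
    l.Triplewise p ↔ ∀ x y z, List.Sublist [x, y, z] l → p x y z := by
  induction l with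
  | nil => simp
  | cons a l ih =>
    rw [List.triplewise_cons, ih, List.pairwise_iff_forall_sublist]
    constructor
    · rintro ⟨h1, h2⟩ x y z h
      rcases List.sublist_cons_iff.1 h with h | ⟨r, hr, h⟩
      · exact h2 _ _ _ h
      · obtain ⟨rfl, rfl⟩ := List.cons.inj hr
        exact h1 h
    · exact fun h => ⟨fun hxy => h _ _ _ (hxy.cons_cons a), fun x y z hs => h _ _ _ (hs.cons a)⟩

/-- No subsequence of `L` is order-isomorphic to `1324` or `2134`. -/
def ListAvoids (L : List ℕ) : Prop :=
  ∀ a b c d, List.Sublist [a, b, c, d] L → ¬ (a < c ∧ c < b ∧ b < d) ∧ ¬ (b < a ∧ a < c ∧ c < d)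

namespace Split

/-- The list that a split encodes. -/
def join (M : ℕ) (t : Split) : List ℕ := t.left ++ 0 :: (t.mid ++ (M + 1) :: t.right)

theorem join_perm (M : ℕ) (t : Split) :
    (join M t).Perm (0 :: (M + 1) :: (t.left ++ t.mid ++ t.right)) := by
  rw [join]
  refine List.perm_middle.trans (List.Perm.cons 0 ?_)
  rw [← List.append_assoc]
  exact List.perm_middle

theorem entries_iff_join {M : ℕ} {t : Split} :
    Entries M t ↔ (join M t).Nodup ∧ ∀ x, x ∈ join M t ↔ x < M + 2 := by
  have hp := join_perm M t
  rw [hp.nodup_iff]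
  simp only [hp.mem_iff]
  generalize hL : t.left ++ t.mid ++ t.right = L
  constructor
  · rintro ⟨h1, h2⟩
    rw [hL] at h1 h2
    simp only [List.nodup_cons, List.mem_cons, h2]
    exact ⟨⟨by omega, by omega, h1⟩, by omega⟩
  · rintro ⟨h1, h2⟩
    simp only [List.nodup_cons, List.mem_cons, not_or] at h1 h2
    refine ⟨hL ▸ h1.2.2, fun x => ?_⟩
    rw [hL]
    have := h2 x
    constructor
    · intro hx
      have : x ≠ 0 := fun e => h1.1.2 (e ▸ hx)
      have : x ≠ M + 1 := fun e => h1.2.1 (e ▸ hx)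
      grind
    · intro hx
      grind

/-- The cuts are recovered as the first `0` and the first `M + 1` after it. -/
theorem join_injOn (M : ℕ) : Set.InjOn (join M) {t | Entries M t} := by
  intro s hs t ht h
  have key : ∀ t, Entries M t → 0 ∉ t.left ∧ M + 1 ∉ t.mid := fun t ht =>
    ⟨fun h => by have := (ht.mem_iff 0).1 (by simp [h]); omega,
      fun h => by have := (ht.mem_iff (M + 1)).1 (by simp [h]); omega⟩
  obtain ⟨s0, sM⟩ := key s hs
  obtain ⟨t0, tM⟩ := key t ht
  have s1 := takeWhile_ne_append_cons (C := s.mid ++ (M + 1) :: s.right) s0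
  have t1 := takeWhile_ne_append_cons (C := t.mid ++ (M + 1) :: t.right) t0
  have s2 := takeWhile_ne_append_cons (C := s.right) sM
  have t2 := takeWhile_ne_append_cons (C := t.right) tM
  rw [join, join] at h
  rw [h] at s1
  have e := (List.cons.inj (s1.2.symm.trans t1.2)).2
  rw [e] at s2
  exact Split.ext (s1.1.symm.trans t1.1) (s2.1.symm.trans t2.1)
    (List.cons.inj (s2.2.symm.trans t2.2)).2

/-- Each violated condition extends to a forbidden pattern: by `0` in front, by `N` at the end, by
both, or, for a pair to the right of `0` and an entry `a` of the left part, by `a 0` in front. -/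
theorem Admissible.of_listAvoids {M : ℕ} {t : Split} (he : Entries M t)
    (h : ListAvoids (join M t)) : Admissible t := by
  have hmem := he.mem_iff
  have hnd := he.nodup
  obtain ⟨A, B, C⟩ := t
  simp only [join] at h hmem hnd
  have hN : ∀ {l}, List.Sublist l A → List.Sublist (l ++ [M + 1]) (A ++ 0 :: (B ++ (M + 1) :: C)) :=
    fun hl => hl.append (.cons _ (List.singleton_sublist.2 (by simp)))
  have h0 : ∀ {l}, List.Sublist l (B ++ (M + 1) :: C) →
      List.Sublist (0 :: l) (A ++ 0 :: (B ++ (M + 1) :: C)) :=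
    fun hl => (hl.cons_cons 0).trans (List.sublist_append_right _ _)
  have hAB : ∀ {a l}, a ∈ A → List.Sublist l (B ++ (M + 1) :: C) →
      List.Sublist (a :: 0 :: l) (A ++ 0 :: (B ++ (M + 1) :: C)) :=
    fun ha hl => (List.singleton_sublist.2 ha).append (hl.cons_cons 0)
  have hBN : ∀ {l}, List.Sublist l B → List.Sublist (l ++ [M + 1]) (B ++ (M + 1) :: C) :=
    fun hl => hl.append (List.singleton_sublist.2 (by simp))
  refine ⟨?_, fun a ha b hb => ?_, ?_, ?_, ?_, fun a ha => ?_⟩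
  · rw [List.pairwise_iff_forall_sublist]
    intro x y hxy
    have hy := (hmem y).1 (by simp [hxy.subset (show y ∈ [x, y] by simp)])
    have hx := (hmem x).1 (by simp [hxy.subset (show x ∈ [x, y] by simp)])
    have h1 := (h _ _ _ _ (h0 (hBN hxy))).1
    have h2 : x ≠ y := by
      have h3 := (List.nodup_append.1 (List.nodup_append.1 hnd).1).2.1.sublist hxy
      simpa using h3
    omega
  · have h1 := (h _ _ _ _ (hAB ha (hBN (List.singleton_sublist.2 hb)))).2
    have h2 : a ≠ b := (List.nodup_append.1 (List.nodup_append.1 hnd).1).2.2 a ha b hb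
    have hx := (hmem a).1 (by simp [ha])
    have hx := (hmem b).1 (by simp [hb])
    omega
  · rw [List.triplewise_iff_forall_sublist]
    rintro x y z hs ⟨h1, h2⟩
    have h3 := (h _ _ _ _ (hN hs)).2
    have hz := (hmem z).1 (by simp [hs.subset (show z ∈ [x, y, z] by simp)])
    omega
  · rw [List.triplewise_iff_forall_sublist]
    rintro x y z hs ⟨h1, h2⟩
    have h3 := (h _ _ _ _ (hN hs)).1
    have hy := (hmem y).1 (by simp [hs.subset (show y ∈ [x, y, z] by simp)])
    omega
  · rw [List.triplewise_iff_forall_sublist]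
    rintro x y z hs ⟨h1, h2⟩
    have h3 := (h _ _ _ _ (h0 (hs.trans ((List.Sublist.refl B).append (.cons _ (.refl C)))))).1
    have hm := hs.subset (show y ∈ [x, y, z] by simp)
    have hy := (hmem y).1 (by grind)
    omega
  · rw [List.pairwise_iff_forall_sublist]
    rintro x y hs ⟨h1, h2⟩
    have h3 := (h _ _ _ _ (hAB ha ((hs.cons (M + 1)).trans (List.sublist_append_right B _)))).2
    have hx := (hmem a).1 (by simp [ha])
    omega

/-- In both patterns the first letter is smaller than the last. As `0 :: B` lies below `A`, no
occurrence can straddle the two, and `0 :: B` is increasing. -/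
theorem Admissible.prefix_213_132 {A B : List ℕ} (h1 : B.Pairwise (· < ·))
    (h2 : ∀ a ∈ A, ∀ b ∈ B, b < a) (hA : ∀ a ∈ A, 0 < a) (hB : ∀ b ∈ B, 0 < b)
    (h3 : A.Triplewise fun x y z => ¬ Is213 x y z) (h4 : A.Triplewise fun x y z => ¬ Is132 x y z)
    {x y z : ℕ} (hs : List.Sublist [x, y, z] (A ++ 0 :: B)) : ¬ Is213 x y z ∧ ¬ Is132 x y z := by
  have hlow : ∀ a ∈ A, ∀ b ∈ 0 :: B, b < a := fun a ha b hb => by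
    rcases List.mem_cons.1 hb with rfl | hb
    · exact hA a ha
    · exact h2 a ha b hb
  have hinc : (0 :: B).Pairwise (· < ·) := List.pairwise_cons.2 ⟨hB, h1⟩
  rw [List.triplewise_iff_forall_sublist] at h3 h4
  obtain ⟨s, s', e, hs1, hs2⟩ := List.sublist_append_iff.1 hs
  simp only [Is213, Is132]
  rcases s with _ | ⟨a, _ | ⟨b, _ | ⟨c, _ | ⟨d, s⟩⟩⟩⟩
  · simp only [List.nil_append] at e
    subst e
    have := hinc.sublist hs2
    simp at this
    omega
  · simp at e
    obtain ⟨rfl, rfl⟩ := e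
    have := hlow x (hs1.subset (by simp)) z (hs2.subset (by simp))
    have := hlow x (hs1.subset (by simp)) y (hs2.subset (by simp))
    omega
  · simp at e
    obtain ⟨rfl, rfl, rfl⟩ := e
    have := hlow x (hs1.subset (by simp)) z (hs2.subset (by simp))
    omega
  · simp at e
    obtain ⟨rfl, rfl, rfl, rfl⟩ := e
    exact ⟨h3 _ _ _ hs1, h4 _ _ _ hs1⟩
  · simp at e

theorem Admissible.listAvoids {M : ℕ} {t : Split} (he : Entries M t)
    (h : Admissible t) : ListAvoids (join M t) := by
  have hmem := he.mem_iff
  obtain ⟨A, B, C⟩ := t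
  obtain ⟨h1, h2, h3, h4, h5, h6⟩ := h
  simp only [join] at hmem h1 h2 h3 h4 h5 h6 ⊢
  have hA : ∀ a ∈ A, 0 < a ∧ a ≤ M := fun a ha => by have := (hmem a).1 (by simp [ha]); omega
  have hB : ∀ a ∈ B, 0 < a ∧ a ≤ M := fun a ha => by have := (hmem a).1 (by simp [ha]); omega
  have hC : ∀ a ∈ C, 0 < a ∧ a ≤ M := fun a ha => by have := (hmem a).1 (by simp [ha]); omega
  have hpre : ∀ {x y z}, List.Sublist [x, y, z] (A ++ 0 :: B) → ¬ Is213 x y z ∧ ¬ Is132 x y z :=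
    fun hs => prefix_213_132 h1 h2 (fun a ha => (hA a ha).1) (fun a ha => (hB a ha).1) h3 h4 hs
  have hright : (B ++ (M + 1) :: C).Triplewise fun x y z => ¬ Is213 x y z :=
    (triplewise_213_insert (fun x hx => by have := hB x hx; omega)
      (fun x hx => by have := hC x hx; omega) (h1.imp ne_of_lt)).2 ⟨h5, h1⟩
  rw [List.triplewise_iff_forall_sublist] at hright
  intro a b c d hs
  rw [← not_or]
  intro hpat
  -- The first three letters form a `132` or a `213`, so they do not all fit before `N`; and `c` is
  -- not `N` because `c < d`.
  have hcd : List.Sublist [c, d] C := by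
    have hs' : List.Sublist [a, b, c, d] ((A ++ 0 :: B) ++ (M + 1) :: C) := by simpa using hs
    obtain ⟨s, s', e, hs1, hs2⟩ := List.sublist_append_iff.1 hs'
    have hcd : List.Sublist [c, d] ((M + 1) :: C) := by
      rcases s with _ | ⟨a', _ | ⟨b', _ | ⟨c', s⟩⟩⟩
      · simp at e
        subst e
        exact .trans (by simp) hs2
      · simp at e
        obtain ⟨rfl, rfl⟩ := e
        exact .trans (by simp) hs2
      · simp at e
        obtain ⟨rfl, rfl, rfl⟩ := e
        exact hs2
      · simp at e
        obtain ⟨rfl, rfl, rfl, e⟩ := e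
        have := hpre (x := a) (y := b) (z := c) (.trans (by simp) hs1)
        simp only [Is213, Is132] at this
        omega
    have hle : ∀ x ∈ C, x ≤ M := fun x hx => (hC x hx).2
    rcases List.sublist_cons_iff.1 hcd with h | ⟨r, hr, h⟩
    · exact h
    · obtain ⟨rfl, rfl⟩ := List.cons.inj hr
      have := hle d (h.subset (by simp))
      omega
  -- If `a` is in the left part, `a < c < d` contradicts `right_anti`. Otherwise a `213` occurs
  -- after `0`: `b c d` for `1324`, `a b d` for `2134`.
  obtain ⟨s, s', e, hs1, hs2⟩ := List.sublist_append_iff.1 hs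
  rcases s with _ | ⟨a', s⟩
  · simp only [List.nil_append] at e
    subst e
    rcases List.sublist_cons_iff.1 hs2 with h | ⟨r, hr, h⟩
    · have k1 := hright b c d (.trans (by simp) h)
      have k2 := hright a b d (.trans (by simp) h)
      simp only [Is213] at k1 k2
      omega
    · obtain ⟨rfl, rfl⟩ := List.cons.inj hr
      have k1 := hright b c d h
      simp only [Is213] at k1
      omega
  · simp at e
    obtain ⟨rfl, -⟩ := e
    have := List.pairwise_iff_forall_sublist.1 (h6 a (hs1.subset (by simp))) hcd
    omega

theorem valid_iff_join {M : ℕ} {t : Split} :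
    Valid M t ↔ (join M t).Nodup ∧ (∀ x, x ∈ join M t ↔ x < M + 2) ∧ ListAvoids (join M t) := by
  rw [Valid, ← and_assoc, ← entries_iff_join]
  exact and_congr_right fun he => ⟨fun h => h.listAvoids he, fun h => .of_listAvoids he h⟩

theorem exists_join_eq {M : ℕ} {L : List ℕ} (h : List.Sublist [0, M + 1] L) :
    ∃ t, join M t = L := by
  obtain ⟨r₁, r₂, rfl, h1, h2⟩ := List.cons_sublist_iff.1 h
  obtain ⟨A, D, rfl⟩ := List.append_of_mem h1
  obtain ⟨E, C, rfl⟩ := List.append_of_mem (List.singleton_sublist.1 h2)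
  exact ⟨⟨A, D ++ E, C⟩, by simp [join]⟩

theorem sublist_join (M : ℕ) (t : Split) : List.Sublist [0, M + 1] (join M t) :=
  ((List.singleton_sublist.2 (by simp) :
    List.Sublist [M + 1] (t.mid ++ (M + 1) :: t.right)).cons_cons 0).trans
      (List.sublist_append_right _ _)

end Split

/-! ### From lists back to permutations -/

/-- The one-line notation with values counted from `0`. -/
def oneLine {n : ℕ} (σ : Equiv.Perm (Fin n)) : List ℕ := List.ofFn fun i => (σ i : ℕ)

theorem oneLine_injective {n : ℕ} : Function.Injective (oneLine (n := n)) := fun _ _ h =>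
  Equiv.ext fun i => Fin.ext (congrFun (List.ofFn_injective h) i)

theorem nodup_oneLine {n : ℕ} (σ : Equiv.Perm (Fin n)) : (oneLine σ).Nodup :=
  List.nodup_ofFn.2 (Fin.val_injective.comp σ.injective)

theorem mem_oneLine {n : ℕ} (σ : Equiv.Perm (Fin n)) (x : ℕ) : x ∈ oneLine σ ↔ x < n := by
  rw [oneLine, List.mem_ofFn]
  constructor
  · rintro ⟨i, rfl⟩
    exact (σ i).2
  · intro h
    exact ⟨σ.symm ⟨x, h⟩, by simp⟩

theorem exists_oneLine_eq {n : ℕ} {L : List ℕ} (hnd : L.Nodup) (hmem : ∀ x, x ∈ L ↔ x < n) :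
    ∃ σ : Equiv.Perm (Fin n), oneLine σ = L := by
  have hlen : L.length = n := by
    have : L.Perm (List.range n) :=
      (List.perm_ext_iff_of_nodup hnd List.nodup_range).2 (by simpa using hmem)
    simpa using this.length_eq
  subst hlen
  let f : Fin L.length → Fin L.length := fun i => ⟨L.get i, (hmem _).1 (L.get_mem i)⟩
  have hf : Function.Injective f := fun i j h =>
    List.nodup_iff_injective_get.1 hnd (congrArg Fin.val h)
  refine ⟨Equiv.ofBijective f (Finite.injective_iff_bijective.1 hf), ?_⟩
  exact List.ofFn_get L

theorem sublist_oneLine_iff {n : ℕ} {σ : Equiv.Perm (Fin n)} {l : List ℕ} :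
    List.Sublist l (oneLine σ) ↔
      ∃ f : Fin l.length → Fin n, StrictMono f ∧ ∀ i, l.get i = σ (f i) := by
  rw [List.sublist_iff_exists_fin_orderEmbedding_get_eq]
  have hlen : (oneLine σ).length = n := List.length_ofFn
  constructor
  · rintro ⟨f, hf⟩
    exact ⟨fun i => (f i).cast hlen, fun i j h => f.strictMono h, fun i => by
      rw [hf i]; simp [oneLine]; rfl⟩
  · rintro ⟨f, hf, h⟩
    exact ⟨OrderEmbedding.ofStrictMono (fun i => (f i).cast hlen.symm) fun i j h => hf h,
      fun i => by rw [h i]; simp [oneLine]; rfl⟩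

theorem containsPattern_1324_iff {n : ℕ} {σ : Equiv.Perm (Fin n)} :
    ContainsPattern σ pattern1324 ↔
      ∃ a b c d, List.Sublist [a, b, c, d] (oneLine σ) ∧ a < c ∧ c < b ∧ b < d := by
  constructor
  · rintro ⟨f, hf, h⟩
    refine ⟨_, _, _, _, sublist_oneLine_iff.2 ⟨f, hf, fun i => ?_⟩,
      (h 0 2).2 (by decide), (h 2 1).2 (by decide), (h 1 3).2 (by decide)⟩
    fin_cases i <;> rfl
  · rintro ⟨a, b, c, d, hs, h⟩
    obtain ⟨f, hf, h'⟩ := sublist_oneLine_iff.1 hs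
    have h0 := h' 0
    have h1 := h' 1
    have h2 := h' 2
    have h3 := h' 3
    simp at h0 h1 h2 h3
    refine ⟨f, hf, fun i j => ?_⟩
    fin_cases i <;> fin_cases j <;> simp [pattern1324] <;> omega

theorem containsPattern_2134_iff {n : ℕ} {σ : Equiv.Perm (Fin n)} :
    ContainsPattern σ pattern2134 ↔
      ∃ a b c d, List.Sublist [a, b, c, d] (oneLine σ) ∧ b < a ∧ a < c ∧ c < d := by
  constructor
  · rintro ⟨f, hf, h⟩
    refine ⟨_, _, _, _, sublist_oneLine_iff.2 ⟨f, hf, fun i => ?_⟩,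
      (h 1 0).2 (by decide), (h 0 2).2 (by decide), (h 2 3).2 (by decide)⟩
    fin_cases i <;> rfl
  · rintro ⟨a, b, c, d, hs, h⟩
    obtain ⟨f, hf, h'⟩ := sublist_oneLine_iff.1 hs
    have h0 := h' 0
    have h1 := h' 1
    have h2 := h' 2
    have h3 := h' 3
    simp at h0 h1 h2 h3
    refine ⟨f, hf, fun i j => ?_⟩
    fin_cases i <;> fin_cases j <;> simp [pattern2134] <;> omega

theorem mem_avoiders_iff_listAvoids {n : ℕ} {σ : Equiv.Perm (Fin n)} :
    σ ∈ avoiders n {pattern1324, pattern2134} ↔ ListAvoids (oneLine σ) := by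
  simp only [avoiders, Set.mem_insert_iff, Set.mem_singleton_iff, Set.mem_ofPred_eq,
    forall_eq_or_imp, forall_eq, containsPattern_1324_iff, containsPattern_2134_iff, ListAvoids]
  push Not
  exact ⟨fun h a b c d hs => ⟨h.1 a b c d hs, h.2 a b c d hs⟩,
    fun h => ⟨fun a b c d hs => (h a b c d hs).1, fun a b c d hs => (h a b c d hs).2⟩⟩

theorem one_before_max_iff {M : ℕ} {σ : Equiv.Perm (Fin (M + 2))} :
    (∃ i j : Fin (M + 2), entry σ i = 1 ∧ entry σ j = M + 2 ∧ i < j) ↔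
      List.Sublist [0, M + 1] (oneLine σ) := by
  rw [sublist_oneLine_iff]
  constructor
  · rintro ⟨i, j, hi, hj, hij⟩
    simp only [entry] at hi hj
    refine ⟨![i, j], ?_, ?_⟩
    · intro a b hab
      fin_cases a <;> fin_cases b <;> simp at hab ⊢
      exact hij
    · intro a
      fin_cases a <;> simp <;> omega
  · rintro ⟨f, hf, h⟩
    have h0 := h 0
    have h1 := h 1
    simp at h0 h1
    refine ⟨f 0, f 1, ?_, ?_, hf (by simp)⟩ <;> simp only [entry] <;> omega

theorem ncard_avoidersOneBeforeMax (M : ℕ) :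
    (avoidersOneBeforeMax (M + 2) {pattern1324, pattern2134}).ncard =
      (2 * M + 1).choose (M + 1) := by
  have himage : oneLine '' avoidersOneBeforeMax (M + 2) {pattern1324, pattern2134} =
      Split.join M '' {t | Split.Valid M t} := by
    ext L
    constructor
    · rintro ⟨σ, ⟨hav, h⟩, rfl⟩
      obtain ⟨t, ht⟩ := Split.exists_join_eq (one_before_max_iff.1 h)
      refine ⟨t, Split.valid_iff_join.2 ?_, ht⟩
      rw [ht]
      exact ⟨nodup_oneLine σ, mem_oneLine σ, mem_avoiders_iff_listAvoids.1 hav⟩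
    · rintro ⟨t, ht, rfl⟩
      obtain ⟨h1, h2, h3⟩ := Split.valid_iff_join.1 ht
      obtain ⟨σ, hσ⟩ := exists_oneLine_eq h1 h2
      refine ⟨σ, ⟨mem_avoiders_iff_listAvoids.2 (hσ ▸ h3), one_before_max_iff.2 ?_⟩, hσ⟩
      rw [hσ]
      exact Split.sublist_join M t
  classical
  rw [← Set.ncard_image_of_injective _ oneLine_injective, himage,
    ((Split.join_injOn M).mono fun t ht => ht.1).ncard_image,
    ← Split.length_generate, ← List.toFinset_card_of_nodup (Split.nodup_generate M),
    ← Set.ncard_coe_finset]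
  congr 1
  ext t
  simp [Split.mem_generate]

/-! ### Reverse-complement symmetry -/

theorem reverseComplement_apply {n : ℕ} (σ : Equiv.Perm (Fin n)) (i : Fin n) :
    reverseComplement σ i = (σ i.rev).rev := rfl

theorem reverseComplement_involutive {n : ℕ} :
    Function.Involutive (reverseComplement (n := n)) := fun σ =>
  Equiv.ext fun i => by simp [reverseComplement_apply]

theorem ContainsPattern.reverseComplement {n m : ℕ} {σ : Equiv.Perm (Fin n)}
    {p : Equiv.Perm (Fin m)} (h : ContainsPattern σ p) :
    ContainsPattern (reverseComplement σ) (reverseComplement p) := by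
  obtain ⟨f, hf, h⟩ := h
  refine ⟨fun i => (f i.rev).rev, fun i j hij => Fin.rev_lt_rev.2 (hf (Fin.rev_lt_rev.2 hij)),
    fun i j => ?_⟩
  simp only [reverseComplement_apply, Fin.rev_rev, Fin.rev_lt_rev]
  exact h _ _

theorem containsPattern_reverseComplement_iff {n m : ℕ} {σ : Equiv.Perm (Fin n)}
    {p : Equiv.Perm (Fin m)} :
    ContainsPattern (reverseComplement σ) (reverseComplement p) ↔ ContainsPattern σ p :=
  ⟨fun h => by simpa [reverseComplement_involutive σ, reverseComplement_involutive p] using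
    h.reverseComplement, fun h => h.reverseComplement⟩

theorem reverseComplement_pattern2134 : reverseComplement pattern2134 = pattern1243 := by decide

theorem reverseComplement_pattern1324 : reverseComplement pattern1324 = pattern1324 := by decide

theorem reverseComplement_mem_iff {n : ℕ} (σ : Equiv.Perm (Fin n)) :
    σ ∈ avoidersOneBeforeMax n {pattern1324, pattern2134} ↔
      reverseComplement σ ∈ avoidersOneBeforeMax n {pattern1243, pattern1324} := by
  have h1 := containsPattern_reverseComplement_iff (σ := σ) (p := pattern1324)
  have h2 := containsPattern_reverseComplement_iff (σ := σ) (p := pattern2134)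
  rw [reverseComplement_pattern1324] at h1
  rw [reverseComplement_pattern2134] at h2
  -- Complementing swaps the values `1` and `n`, and reversing swaps their order, so `1` remains on
  -- the left.
  have hpos : ∀ τ : Equiv.Perm (Fin n),
      (∃ i j : Fin n, entry τ i = 1 ∧ entry τ j = n ∧ i < j) →
        ∃ i j : Fin n, entry (reverseComplement τ) i = 1 ∧
          entry (reverseComplement τ) j = n ∧ i < j := by
    rintro τ ⟨i, j, hi, hj, hij⟩
    refine ⟨j.rev, i.rev, ?_, ?_, Fin.rev_lt_rev.2 hij⟩ <;>
      simp only [entry, reverseComplement_apply, Fin.rev_rev, Fin.val_rev] at * <;> omega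
  simp only [avoidersOneBeforeMax, avoiders, Set.mem_ofPred_eq, Set.mem_insert_iff,
    Set.mem_singleton_iff, forall_eq_or_imp, forall_eq, h1, h2]
  constructor
  · rintro ⟨⟨ha, hb⟩, h⟩
    exact ⟨⟨hb, ha⟩, hpos σ h⟩
  · rintro ⟨⟨hb, ha⟩, h⟩
    refine ⟨⟨ha, hb⟩, ?_⟩
    simpa only [reverseComplement_involutive σ] using hpos _ h

/-! ### Refinement by distance, and the theorem -/

theorem ncard_avoidersOneBeforeMax_eq_sum (n : ℕ) {m : ℕ} (P : Set (Equiv.Perm (Fin m))) :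
    (avoidersOneBeforeMax n P).ncard =
      ∑ k ∈ Finset.Icc 1 (n - 1), (avoidersOneBeforeMaxAt n k P).ncard := by
  have hunion : avoidersOneBeforeMax n P =
      ⋃ k ∈ Finset.Icc 1 (n - 1), avoidersOneBeforeMaxAt n k P := by
    ext σ
    simp only [avoidersOneBeforeMax, avoidersOneBeforeMaxAt, Set.mem_ofPred_eq, Set.mem_iUnion,
      Finset.mem_Icc, exists_prop]
    constructor
    · rintro ⟨h, i, j, hi, hj, hij⟩
      have := j.2
      have hij' : (i : ℕ) < j := hij
      exact ⟨j - i, by omega, h, i, j, hi, hj, by omega⟩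
    · rintro ⟨k, hk, h, i, j, hi, hj, hij⟩
      exact ⟨h, i, j, hi, hj, Fin.lt_def.2 (by omega)⟩
  rw [hunion, ← finsum_mem_coe_finset]
  refine Set.Finite.ncard_biUnion (Finset.finite_toSet _) (fun k _ => Set.toFinite _)
    fun k _ l _ hkl => ?_
  refine Set.disjoint_left.2 ?_
  rintro σ ⟨-, i, j, hi, hj, hij⟩ ⟨-, i', j', hi', hj', hij'⟩
  have e1 : i = i' := σ.injective (Fin.ext (by simp only [entry] at *; omega))
  have e2 : j = j' := σ.injective (Fin.ext (by simp only [entry] at *; omega))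
  subst e1 e2
  exact hkl (by omega)

theorem mainTheorem11 (n : ℕ) (hn : 2 ≤ n) :
    (avoidersOneBeforeMax n {pattern1243, pattern1324}).ncard =
        ∑ k ∈ Finset.Icc 1 (n - 1), (avoidersOneBeforeMaxAt n k {pattern1243, pattern1324}).ncard ∧
      (avoidersOneBeforeMax n {pattern1243, pattern1324}).ncard =
        Nat.choose (2 * n - 3) (n - 1) ∧
      (avoidersOneBeforeMax n {pattern1324, pattern2134}).ncard =
        Nat.choose (2 * n - 3) (n - 1) ∧
      ∀ σ : Equiv.Perm (Fin n),
        σ ∈ avoidersOneBeforeMax n {pattern1324, pattern2134} ↔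
          reverseComplement σ ∈ avoidersOneBeforeMax n {pattern1243, pattern1324} := by
  have hcount : (avoidersOneBeforeMax n {pattern1324, pattern2134}).ncard =
      Nat.choose (2 * n - 3) (n - 1) := by
    obtain ⟨M, rfl⟩ := Nat.exists_eq_add_of_le' hn
    rw [ncard_avoidersOneBeforeMax]
    congr 1
  have hrc : avoidersOneBeforeMax n {pattern1243, pattern1324} =
      reverseComplement '' avoidersOneBeforeMax n {pattern1324, pattern2134} := by
    ext σ
    constructor
    · intro h
      refine ⟨reverseComplement σ, ?_, reverseComplement_involutive σ⟩
      rwa [reverseComplement_mem_iff, reverseComplement_involutive σ]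
    · rintro ⟨τ, h, rfl⟩
      exact (reverseComplement_mem_iff τ).1 h
  refine ⟨ncard_avoidersOneBeforeMax_eq_sum n _, ?_, hcount, reverseComplement_mem_iff⟩
  rw [hrc, Set.ncard_image_of_injective _ reverseComplement_involutive.injective, hcount]
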